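/- Let $M$ be a finitely generated abelian group and let $A=\bigoplus_{m\in M}A_m$ be an $M$-graded commutative ring. A homogeneous element is a non-zero element of some $A_m$; $m$ is its degree. For a family $f$ of homogeneous elements of $A$, let $M_f\subseteq M$ be the subgroup generated by the degrees of the members of $f$, and call $f$ *relevant* if every $x\in M$ has a multiple $nx$, $n>0$, in the subgroup of $M$ generated by the degrees of the homogeneous divisors of members of $f$. For an $M$-graded $A$-module $Q$, let $Q_{(f)}$ be the degree-zero part of the localization of $Q$ at the multiplicative subset of $A$ generated by $f$; in particular $A_{(f)}$ is a ring and $Q_{(f)}$ is an $A_{(f)}$-module. For finite relevant $f,g$ the canonical map $A_{(f)}\to A_{(f\cup g)}$ induces an open immersion $\mathrm{Spec}\,A_{(f\cup g)}\to\mathrm{Spec}\,A_{(f)}$, and $X=\mathrm{Proj}(A)$ is the scheme obtained by gluing the $U_f=\mathrm{Spec}\,A_{(f)}$, $f$ finite relevant, along the $U_{f\cup g}$. For an arbitrary relevant family $f$, write $U_f\subseteq X$ for the image of the canonical map $\mathrm{Spec}\,A_{(f)}\to \mathrm{Spec}\,A_{(g)}\to X$, where $g\subseteq f$ is any finite relevant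 subfamily. Let $\widetilde Q$ be the quasi-coherent $\mathcal O_X$-module obtained by gluing the sheaves on the $U_f$ ($f$ finite relevant) associated with the modules $Q_{(f)}$, so that $\Gamma(U_f,\widetilde Q)=Q_{(f)}$. For $\alpha\in M$, let $A(\alpha)$ be the graded $A$-module with $A(\alpha)_\beta=A_{\alpha+\beta}$ and put $\mathcal O_X(\alpha)=\widetilde{A(\alpha)}$. **Proposition (Invertibility).** Assume that there is a set $\mathcal F$ of relevant families of homogeneous elements of $A$ such that $M_f=M$ for all $f\in\mathcal F$ and $\bigcup_{f\in\mathcal F}U_f=X$. Then for every $\alpha\in M$ the $\mathcal O_X$-module $\mathcal O_X(\alpha)$ is invertible, i.e. locally isomorphic to $\mathcal O_X$. -/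

import Mathlib

open CategoryTheory AlgebraicGeometry

universe u

set_option linter.unusedSectionVars false
set_option linter.style.haveILetI false

noncomputable section

namespace GradedProj

section Rings

variable {M A : Type u} [AddCommGroup M] [DecidableEq M] [CommRing A]
  (𝒜 : M → AddSubgroup A) [GradedRing 𝒜]

/-- A homogeneous element: a non-zero element lying in one of the graded pieces. -/
def IsHomogeneousElement (a : A) : Prop := a ≠ 0 ∧ ∃ m : M, a ∈ 𝒜 m

/-- The subgroup of `M` generated by the degrees of the elements of `f`. -/
def degreeGroup (f : Set A) : AddSubgroup M :=
  AddSubgroup.closure {m | ∃ a ∈ f, a ≠ 0 ∧ a ∈ 𝒜 m}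

/-- The homogeneous divisors of the elements of `f`. -/
def homogeneousDivisors (f : Set A) : Set A :=
  {b | IsHomogeneousElement 𝒜 b ∧ ∃ a ∈ f, b ∣ a}

/-- A family of homogeneous elements is relevant if every degree has a positive multiple in the
group generated by the degrees of the homogeneous divisors of its members. -/
structure IsRelevant (f : Set A) : Prop where
  homogeneous : ∀ a ∈ f, IsHomogeneousElement 𝒜 a
  exists_nsmul_mem : ∀ x : M, ∃ n : ℕ, 0 < n ∧ n • x ∈ degreeGroup 𝒜 (homogeneousDivisors 𝒜 f)

/-- The potion of `f`: the degree zero part of the localization of `A` at the multiplicative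
subset generated by `f`. -/
abbrev potion (f : Set A) : Type u := HomogeneousLocalization 𝒜 (Submonoid.closure f)

/-- The canonical map `a / s ↦ a / s` between potions. -/
abbrev potionMap {f g : Set A} (h : f ⊆ g) : potion 𝒜 f →+* potion 𝒜 g :=
  HomogeneousLocalization.mapId 𝒜 (Submonoid.closure_mono h)

variable {𝒜}

theorem val_potionMap_mk {f g : Set A} (h : f ⊆ g)
    (c : HomogeneousLocalization.NumDenSameDeg 𝒜 (Submonoid.closure f)) :
    (potionMap 𝒜 h (HomogeneousLocalization.mk c)).val =
      Localization.mk (c.num : A) ⟨c.den, Submonoid.closure_mono h c.den_mem⟩ := rfl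

theorem IsRelevant.mono {f g : Set A} (hf : IsRelevant 𝒜 f) (h : f ⊆ g)
    (hg : ∀ a ∈ g, IsHomogeneousElement 𝒜 a) : IsRelevant 𝒜 g where
  homogeneous := hg
  exists_nsmul_mem x := by
    obtain ⟨n, hn, hx⟩ := hf.exists_nsmul_mem x
    refine ⟨n, hn, AddSubgroup.closure_mono ?_ hx⟩
    rintro m ⟨a, ⟨ha, b, hb, hab⟩, ha'⟩
    exact ⟨a, ⟨ha, b, h hb, hab⟩, ha'⟩

theorem IsRelevant.union {f g : Set A} (hf : IsRelevant 𝒜 f) (hg : IsRelevant 𝒜 g) :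
    IsRelevant 𝒜 (f ∪ g) :=
  hf.mono Set.subset_union_left (by
    rintro a (ha | ha)
    exacts [hf.homogeneous a ha, hg.homogeneous a ha])

theorem exists_mem_of_mem_closure {f : Set A} (hf : ∀ a ∈ f, IsHomogeneousElement 𝒜 a) {s : A}
    (hs : s ∈ Submonoid.closure f) : ∃ m, s ∈ 𝒜 m := by
  induction hs using Submonoid.closure_induction with
  | mem x hx => exact (hf x hx).2
  | one => exact ⟨0, SetLike.GradedOne.one_mem⟩
  | mul x y _ _ hx hy =>
    obtain ⟨i, hi⟩ := hx
    obtain ⟨j, hj⟩ := hy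
    exact ⟨i + j, SetLike.GradedMul.mul_mem hi hj⟩

theorem exists_homogeneous_cofactor {c t : A} {i k : M} (hc : c ∈ 𝒜 i) (ht : t ∈ 𝒜 k)
    (h : c ∣ t) : ∃ e ∈ 𝒜 (k - i), c * e = t := by
  obtain ⟨e, rfl⟩ := h
  refine ⟨DirectSum.decompose 𝒜 e (k - i), SetLike.coe_mem _, ?_⟩
  rw [← DirectSum.coe_decompose_mul_add_of_left_mem 𝒜 hc, add_sub_cancel,
    DirectSum.decompose_of_mem_same 𝒜 ht]

/-- `m` is a difference of degrees of two homogeneous elements `s` and `c`, where `s` belongs to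
the multiplicative subset generated by `f` and `c` divides an element of it. -/
theorem exists_balance {f : Set A} (hf : ∀ a ∈ f, IsHomogeneousElement 𝒜 a) {m : M}
    (hm : m ∈ degreeGroup 𝒜 (homogeneousDivisors 𝒜 f)) :
    ∃ c s i, c ∈ 𝒜 i ∧ s ∈ 𝒜 (m + i) ∧ s ∈ Submonoid.closure f ∧
      ∃ t ∈ Submonoid.closure f, c ∣ t := by
  induction hm using AddSubgroup.closure_induction with
  | mem m hm =>
    obtain ⟨d, ⟨-, a, haf, hda⟩, -, hd⟩ := hm
    obtain ⟨k, hk⟩ := (hf a haf).2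
    obtain ⟨e, he, rfl⟩ := exists_homogeneous_cofactor hd hk hda
    exact ⟨e, d * e, k - m, he, by simpa using hk, Submonoid.subset_closure haf,
      d * e, Submonoid.subset_closure haf, dvd_mul_left _ _⟩
  | zero =>
    exact ⟨1, 1, 0, SetLike.GradedOne.one_mem, by simpa using SetLike.GradedOne.one_mem,
      one_mem _, 1, one_mem _, dvd_rfl⟩
  | add x y _ _ hx hy =>
    obtain ⟨c, s, i, hc, hs, hsf, t, ht, hct⟩ := hx
    obtain ⟨c', s', i', hc', hs', hsf', t', ht', hct'⟩ := hy
    refine ⟨c * c', s * s', i + i', SetLike.GradedMul.mul_mem hc hc', ?_, mul_mem hsf hsf',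
      t * t', mul_mem ht ht', mul_dvd_mul hct hct'⟩
    rw [add_add_add_comm]
    exact SetLike.GradedMul.mul_mem hs hs'
  | neg x _ hx =>
    obtain ⟨c, s, i, hc, hs, hsf, t, ht, hct⟩ := hx
    obtain ⟨k, hk⟩ := exists_mem_of_mem_closure hf ht
    obtain ⟨e, he, rfl⟩ := exists_homogeneous_cofactor hc hk hct
    refine ⟨s * e, c * e, (x + i) + (k - i), SetLike.GradedMul.mul_mem hs he, ?_, ht,
      s * (c * e), mul_mem hsf ht, ⟨c, by ring⟩⟩
    convert hk using 1
    congr 1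
    abel

/-- `w` is a fraction `P ^ n * c / s` of degree zero, where `n > 0` and `c` becomes invertible
when the elements of `f` are inverted. -/
def IsLocElement (f : Set A) (P : A) (w : potion 𝒜 f) : Prop :=
  ∃ n : ℕ, 0 < n ∧ ∃ c : A, (∃ i, c ∈ 𝒜 i) ∧ (∃ t ∈ Submonoid.closure f, c ∣ t) ∧
    ∃ (j : M) (h : P ^ n * c ∈ 𝒜 j) (s : A) (h' : s ∈ 𝒜 j) (hs : s ∈ Submonoid.closure f),
      w = HomogeneousLocalization.mk ⟨j, ⟨P ^ n * c, h⟩, ⟨s, h'⟩, hs⟩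

theorem exists_isLocElement {f : Set A} (hf : IsRelevant 𝒜 f) {P : A} (hP : ∃ p, P ∈ 𝒜 p) :
    ∃ w : potion 𝒜 f, IsLocElement f P w := by
  obtain ⟨p, hp⟩ := hP
  obtain ⟨n, hn, hm⟩ := hf.exists_nsmul_mem p
  obtain ⟨c, s, i, hc, hs, hsf, t, ht, hct⟩ := exists_balance hf.homogeneous hm
  exact ⟨_, n, hn, c, ⟨i, hc⟩, ⟨t, ht, hct⟩, n • p + i,
    SetLike.GradedMul.mul_mem (SetLike.pow_mem_graded n hp) hc, s, hs, hsf, rfl⟩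

theorem IsLocElement.mul {f : Set A} {P P' : A} {w w' : potion 𝒜 f} (hw : IsLocElement f P w)
    (hw' : IsLocElement f P' w') :
    ∃ n m : ℕ, 0 < n ∧ 0 < m ∧ IsLocElement f (P * P') (w ^ n * w' ^ m) := by
  obtain ⟨n, hn, c, ⟨i, hi⟩, ⟨t, ht, hct⟩, j, h, s, h', hs, rfl⟩ := hw
  obtain ⟨m, hm, d, ⟨i', hi'⟩, ⟨t', ht', hct'⟩, j', k, s', k', hs', rfl⟩ := hw'
  refine ⟨m, n, hm, hn, n * m, Nat.mul_pos hn hm, c ^ m * d ^ n,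
    ⟨_, SetLike.GradedMul.mul_mem (SetLike.pow_mem_graded m hi) (SetLike.pow_mem_graded n hi')⟩,
    ⟨t ^ m * t' ^ n, mul_mem (pow_mem ht _) (pow_mem ht' _),
      mul_dvd_mul (pow_dvd_pow_of_dvd hct _) (pow_dvd_pow_of_dvd hct' _)⟩,
    m • j + n • j', ?_, s ^ m * s' ^ n,
    SetLike.GradedMul.mul_mem (SetLike.pow_mem_graded m h') (SetLike.pow_mem_graded n k'),
    mul_mem (pow_mem hs _) (pow_mem hs' _), ?_⟩
  · convert SetLike.GradedMul.mul_mem (SetLike.pow_mem_graded m h) (SetLike.pow_mem_graded n k)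
      using 1
    ring
  · apply HomogeneousLocalization.val_injective
    simp only [HomogeneousLocalization.val_mul, HomogeneousLocalization.val_pow,
      HomogeneousLocalization.val_mk, Localization.mk_pow, Localization.mk_mul]
    congr 1
    ring

theorem IsLocElement.isLocalization {f g : Set A} (h : f ⊆ g)
    (hg : ∀ a ∈ g, IsHomogeneousElement 𝒜 a) {P : A} (hPg : P ∈ Submonoid.closure g)
    (hP : ∀ s ∈ Submonoid.closure g, ∃ N : ℕ, s ∣ P ^ N) {w : potion 𝒜 f}
    (hw : IsLocElement f P w) :
    letI := (potionMap 𝒜 h).toAlgebra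
    IsLocalization.Away w (potion 𝒜 g) := by
  letI := (potionMap 𝒜 h).toAlgebra
  have hf : ∀ a ∈ f, IsHomogeneousElement 𝒜 a := fun a ha ↦ hg a (h ha)
  have hle := Submonoid.closure_mono h
  obtain ⟨n, hn, c, ⟨i, hi⟩, ⟨t, ht, hct⟩, j, hj, s, hs, hsf, rfl⟩ := hw
  have key : ∀ σ ∈ Submonoid.closure g, ∃ N : ℕ, σ ∣ (P ^ n * c) ^ N := by
    intro σ hσ
    obtain ⟨N, hN⟩ := hP σ hσ
    refine ⟨N, ?_⟩
    rw [mul_pow, ← pow_mul]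
    exact (hN.trans (pow_dvd_pow _ (Nat.le_mul_of_pos_left _ hn))).mul_right _
  refine ⟨⟨?_, ?_, ?_⟩⟩
  · rintro ⟨_, N, rfl⟩
    simp only [map_pow]
    refine IsUnit.pow _ ?_
    obtain ⟨k, hk⟩ := exists_mem_of_mem_closure hf ht
    obtain ⟨e, he, rfl⟩ := exists_homogeneous_cofactor hi hk hct
    refine IsUnit.of_mul_eq_one (HomogeneousLocalization.mk ⟨j + (k - i), ⟨s * e,
      SetLike.GradedMul.mul_mem hs he⟩, ⟨P ^ n * c * e, SetLike.GradedMul.mul_mem hj he⟩, ?_⟩) ?_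
    · change P ^ n * c * e ∈ _
      rw [mul_assoc]
      exact mul_mem (pow_mem hPg _) (hle ht)
    · apply HomogeneousLocalization.val_injective
      simp only [RingHom.algebraMap_toAlgebra, val_potionMap_mk,
        HomogeneousLocalization.val_mul, HomogeneousLocalization.val_mk, Localization.mk_mul,
        HomogeneousLocalization.val_one]
      rw [← Localization.mk_one, Localization.mk_eq_mk_iff, Localization.r_iff_exists]
      refine ⟨1, ?_⟩
      simp
      ring
  · intro z
    obtain ⟨⟨d, ⟨x, hx⟩, ⟨σ, hσ⟩, hσg⟩, rfl⟩ := HomogeneousLocalization.mk_surjective z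
    obtain ⟨N, hN⟩ := key σ hσg
    obtain ⟨e, he, heq⟩ := exists_homogeneous_cofactor hσ (SetLike.pow_mem_graded N hj) hN
    refine ⟨⟨HomogeneousLocalization.mk ⟨N • j, ⟨x * e, ?_⟩, ⟨s ^ N, SetLike.pow_mem_graded N hs⟩,
      pow_mem hsf N⟩, ⟨_, N, rfl⟩⟩, ?_⟩
    · convert SetLike.GradedMul.mul_mem hx he using 2
      abel
    · apply HomogeneousLocalization.val_injective
      simp only [RingHom.algebraMap_toAlgebra, val_potionMap_mk,
        HomogeneousLocalization.val_mul, HomogeneousLocalization.val_mk, Localization.mk_mul,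
        map_pow, HomogeneousLocalization.val_pow, Localization.mk_pow]
      rw [Localization.mk_eq_mk_iff, Localization.r_iff_exists]
      refine ⟨1, ?_⟩
      simp only [Submonoid.coe_one, Submonoid.coe_mul,
        SubmonoidClass.mk_pow, one_mul]
      rw [← heq]
      ring
  · intro y z hyz
    obtain ⟨⟨d, ⟨x, hx⟩, ⟨σ, hσ⟩, hσf⟩, rfl⟩ := HomogeneousLocalization.mk_surjective y
    obtain ⟨⟨d', ⟨x', hx'⟩, ⟨σ', hσ'⟩, hσf'⟩, rfl⟩ := HomogeneousLocalization.mk_surjective z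
    have := congr_arg HomogeneousLocalization.val hyz
    simp only [RingHom.algebraMap_toAlgebra, val_potionMap_mk] at this
    rw [Localization.mk_eq_mk_iff, Localization.r_iff_exists] at this
    obtain ⟨⟨τ, hτ⟩, h0⟩ := this
    obtain ⟨N, e, hN⟩ := key τ hτ
    refine ⟨⟨_, N, rfl⟩, ?_⟩
    apply HomogeneousLocalization.val_injective
    simp only [HomogeneousLocalization.val_mul, HomogeneousLocalization.val_mk,
      Localization.mk_mul, HomogeneousLocalization.val_pow, Localization.mk_pow]
    rw [Localization.mk_eq_mk_iff, Localization.r_iff_exists]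
    refine ⟨1, ?_⟩
    simp only [Submonoid.coe_one, Submonoid.coe_mul, SubmonoidClass.mk_pow, one_mul]
    rw [hN]
    linear_combination (s ^ N * e) * h0

theorem exists_generator {g : Set A} (hgf : g.Finite) :
    ∃ P ∈ Submonoid.closure g, ∀ s ∈ Submonoid.closure g, ∃ N : ℕ, s ∣ P ^ N := by
  refine ⟨∏ b ∈ hgf.toFinset, b, Submonoid.prod_mem _ fun b hb ↦
    Submonoid.subset_closure (by simpa using hb), fun s hs ↦ ?_⟩
  induction hs using Submonoid.closure_induction with
  | mem x hx => exact ⟨1, by simpa using Finset.dvd_prod_of_mem (fun b ↦ b) (by simpa using hx)⟩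
  | one => exact ⟨0, by simp⟩
  | mul x y _ _ hx hy =>
    obtain ⟨N, hN⟩ := hx
    obtain ⟨N', hN'⟩ := hy
    exact ⟨N + N', by rw [pow_add]; exact mul_dvd_mul hN hN'⟩

end Rings

section Proj

variable {M A : Type u} [AddCommGroup M] [DecidableEq M] [CommRing A]
  (𝒜 : M → AddSubgroup A) [GradedRing 𝒜]

/-- The finite relevant families, ordered by inclusion. -/
@[ext]
structure FinRelevant : Type u where
  carrier : Set A
  finite : carrier.Finite
  isRelevant : IsRelevant 𝒜 carrier

instance : PartialOrder (FinRelevant 𝒜) :=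
  PartialOrder.lift FinRelevant.carrier fun _ _ h ↦ FinRelevant.ext h

variable {𝒜} in
/-- The union of two finite relevant families. -/
def FinRelevant.union (f g : FinRelevant 𝒜) : FinRelevant 𝒜 :=
  ⟨f.carrier ∪ g.carrier, f.finite.union g.finite, f.isRelevant.union g.isRelevant⟩

/-- The functor sending a finite relevant family to its potion. -/
def potionFunctor : FinRelevant 𝒜 ⥤ CommRingCat.{u} where
  obj f := CommRingCat.of (potion 𝒜 f.carrier)
  map {f g} h := CommRingCat.ofHom (potionMap 𝒜 (f := f.carrier) (g := g.carrier) (leOfHom h))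
  map_id f := by
    ext x
    obtain ⟨c, rfl⟩ := HomogeneousLocalization.mk_surjective x
    rfl
  map_comp {f g k} h h' := by
    ext x
    obtain ⟨c, rfl⟩ := HomogeneousLocalization.mk_surjective x
    rfl

/-- The diagram of the affine schemes `U_f = Spec A_(f)`, for `f` finite relevant, with the maps
`U_g ⟶ U_f` for `f ⊆ g`. -/
def projDiagram : (FinRelevant 𝒜)ᵒᵖ ⥤ Scheme.{u} := (potionFunctor 𝒜).op ⋙ Scheme.Spec

variable {𝒜}

theorem range_specMap {f g : FinRelevant 𝒜} (h : f ≤ g) {P : A}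
    (hPg : P ∈ Submonoid.closure g.carrier)
    (hP : ∀ s ∈ Submonoid.closure g.carrier, ∃ N : ℕ, s ∣ P ^ N) {w : potion 𝒜 f.carrier}
    (hw : IsLocElement f.carrier P w) :
    Set.range (PrimeSpectrum.comap (potionMap 𝒜 (f := f.carrier) (g := g.carrier) h)) =
      PrimeSpectrum.basicOpen w := by
  letI := (potionMap 𝒜 (f := f.carrier) (g := g.carrier) h).toAlgebra
  haveI : IsLocalization.Away w (potion 𝒜 g.carrier) :=
    hw.isLocalization h g.isRelevant.homogeneous hPg hP
  exact PrimeSpectrum.localization_away_comap_range (potion 𝒜 g.carrier) w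

instance isOpenImmersion_projDiagram_map {f g : (FinRelevant 𝒜)ᵒᵖ} (h : f ⟶ g) :
    IsOpenImmersion ((projDiagram 𝒜).map h) := by
  obtain ⟨P, hPg, hP⟩ := exists_generator f.unop.finite
  obtain ⟨w, hw⟩ := exists_isLocElement g.unop.isRelevant
    (exists_mem_of_mem_closure f.unop.isRelevant.homogeneous hPg)
  letI := (potionMap 𝒜 (f := g.unop.carrier) (g := f.unop.carrier) (leOfHom h.unop)).toAlgebra
  haveI : IsLocalization.Away w (potion 𝒜 f.unop.carrier) :=
    hw.isLocalization (leOfHom h.unop) f.unop.isRelevant.homogeneous hPg hP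
  exact IsOpenImmersion.of_isLocalization (R := potion 𝒜 g.unop.carrier) w

instance isLocallyDirected_projDiagram :
    (projDiagram 𝒜 ⋙ Scheme.forget).IsLocallyDirected where
  cond {i j k} fi fj xi xj hx := by
    obtain ⟨P, hPi, hP⟩ := exists_generator i.unop.finite
    obtain ⟨P', hPj, hP'⟩ := exists_generator j.unop.finite
    obtain ⟨w, hw⟩ := exists_isLocElement k.unop.isRelevant
      (exists_mem_of_mem_closure i.unop.isRelevant.homogeneous hPi)
    obtain ⟨w', hw'⟩ := exists_isLocElement k.unop.isRelevant
      (exists_mem_of_mem_closure j.unop.isRelevant.homogeneous hPj)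
    obtain ⟨n, m, hn, hm, hv⟩ := hw.mul hw'
    have hki : k.unop ≤ i.unop := leOfHom fi.unop
    have hkj : k.unop ≤ j.unop := leOfHom fj.unop
    have hil : i.unop ≤ i.unop.union j.unop := fun _ ↦ Or.inl
    have hjl : j.unop ≤ i.unop.union j.unop := fun _ ↦ Or.inr
    have hPl : P * P' ∈ Submonoid.closure (i.unop.union j.unop).carrier :=
      mul_mem (Submonoid.closure_mono hil hPi) (Submonoid.closure_mono hjl hPj)
    have hl : ∀ s ∈ Submonoid.closure (i.unop.union j.unop).carrier, ∃ N : ℕ, s ∣ (P * P') ^ N := by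
      intro s hs
      rw [show (i.unop.union j.unop).carrier = i.unop.carrier ∪ j.unop.carrier from rfl, Submonoid.closure_union,
        Submonoid.mem_sup] at hs
      obtain ⟨y, hy, z, hz, rfl⟩ := hs
      obtain ⟨N, hN⟩ := hP y hy
      obtain ⟨N', hN'⟩ := hP' z hz
      refine ⟨N + N', ?_⟩
      rw [mul_pow]
      exact mul_dvd_mul (hN.trans (pow_dvd_pow _ (Nat.le_add_right _ _)))
        (hN'.trans (pow_dvd_pow _ (Nat.le_add_left _ _)))
    have ri := range_specMap hki hPi hP hw
    have rj := range_specMap hkj hPj hP' hw'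
    have rl := range_specMap (hki.trans hil) hPl hl hv
    let l : (FinRelevant 𝒜)ᵒᵖ := .op (i.unop.union j.unop)
    let fli : l ⟶ i := (homOfLE hil).op
    let flj : l ⟶ j := (homOfLE hjl).op
    have h1 : (projDiagram 𝒜).map fi xi ∈ Set.range ((projDiagram 𝒜).map (fli ≫ fi)) := by
      change _ ∈ Set.range (PrimeSpectrum.comap (potionMap 𝒜 (hki.trans hil)))
      rw [rl, PrimeSpectrum.basicOpen_mul, PrimeSpectrum.basicOpen_pow _ _ hn,
        PrimeSpectrum.basicOpen_pow _ _ hm]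
      refine ⟨?_, ?_⟩
      · rw [← ri]
        exact ⟨xi, rfl⟩
      · rw [← rj]
        exact ⟨xj, hx.symm⟩
    obtain ⟨z, hz⟩ := h1
    refine ⟨l, fli, flj, z, ?_, ?_⟩
    · apply ((projDiagram 𝒜).map fi).isOpenEmbedding.injective
      rw [← hz, Functor.map_comp]
      rfl
    · apply ((projDiagram 𝒜).map fj).isOpenEmbedding.injective
      refine Eq.trans ?_ hx
      refine Eq.trans ?_ hz
      rw [show fli ≫ fi = flj ≫ fj from rfl, Functor.map_comp]
      rfl

instance : Quiver.IsThin (FinRelevant 𝒜)ᵒᵖ := fun _ _ ↦ inferInstance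

variable (𝒜) in
/-- `Proj A`: the scheme obtained by gluing the affine schemes `U_f`, for `f` finite relevant, along
the open subschemes `U_{f ∪ g}` of `U_f` and `U_g`. -/
def Proj : Scheme.{u} := Limits.colimit (projDiagram 𝒜)

/-- The chart `U_f = Spec A_(f) ⟶ Proj A`, for `f` finite relevant. -/
def chart (f : FinRelevant 𝒜) : Spec (CommRingCat.of (potion 𝒜 f.carrier)) ⟶ Proj 𝒜 :=
  Limits.colimit.ι (projDiagram 𝒜) (.op f)

instance (f : FinRelevant 𝒜) : IsOpenImmersion (chart f) :=
  inferInstanceAs (IsOpenImmersion (Limits.colimit.ι (projDiagram 𝒜) (.op f)))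

/-- The map `U_g ⟶ U_f` for `f ⊆ g`. -/
def specPotionMap {f g : Set A} (h : f ⊆ g) :
    Spec (CommRingCat.of (potion 𝒜 g)) ⟶ Spec (CommRingCat.of (potion 𝒜 f)) :=
  Spec.map (CommRingCat.ofHom (potionMap 𝒜 h))

theorem specPotionMap_chart {f g : FinRelevant 𝒜} (h : f ≤ g) :
    specPotionMap (𝒜 := 𝒜) (f := f.carrier) (g := g.carrier) h ≫ chart f = chart g :=
  Limits.colimit.w (projDiagram 𝒜) (homOfLE h).op

/-- The charts cover `Proj A`. -/
theorem exists_chart (x : Proj 𝒜) : ∃ f : FinRelevant 𝒜, x ∈ Set.range (chart f) := by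
  obtain ⟨i, xi, h⟩ := Scheme.IsLocallyDirected.ι_jointly_surjective (projDiagram 𝒜) x
  exact ⟨i.unop, xi, h⟩

/-- `U_f ∩ U_g = U_{f ∪ g}` in `Proj A`. -/
theorem range_chart_inter (f g : FinRelevant 𝒜) :
    Set.range (chart f) ∩ Set.range (chart g) = Set.range (chart (f.union g)) := by
  have hf : f ≤ f.union g := fun _ ↦ Or.inl
  have hg : g ≤ f.union g := fun _ ↦ Or.inr
  apply Set.Subset.antisymm
  · rintro _ ⟨⟨x, rfl⟩, ⟨y, hy⟩⟩
    obtain ⟨k, fi, fj, z, hz, -⟩ :=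
      (Scheme.IsLocallyDirected.ι_eq_ι_iff (projDiagram 𝒜) (i := .op f) (j := .op g)).mp hy.symm
    have hk : f.union g ≤ k.unop := Set.union_subset (leOfHom fi.unop) (leOfHom fj.unop)
    refine ⟨specPotionMap (𝒜 := 𝒜) hk z, ?_⟩
    have h1 : specPotionMap (𝒜 := 𝒜) hk ≫ chart (f.union g) =
        (projDiagram 𝒜).map fi ≫ chart f :=
      (specPotionMap_chart hk).trans (Limits.colimit.w (projDiagram 𝒜) fi).symm
    rw [← hz]
    exact congr($h1 z)
  · rintro _ ⟨x, rfl⟩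
    exact ⟨⟨specPotionMap (𝒜 := 𝒜) hf x, by rw [← Scheme.Hom.comp_apply, specPotionMap_chart hf]⟩,
      ⟨specPotionMap (𝒜 := 𝒜) hg x, by rw [← Scheme.Hom.comp_apply, specPotionMap_chart hg]⟩⟩

/-- The subset `U_f` of `Proj A`, for `f` relevant but possibly infinite: the image of the
canonical map `Spec A_(f) ⟶ U_g ⟶ Proj A`, which does not depend on the finite relevant family
`g ⊆ f`. If `f` is finite this is the image of the chart of `f`, see `piece_eq_range_chart`. -/
def piece (𝒜 : M → AddSubgroup A) [GradedRing 𝒜] (f : Set A) : Set (Proj 𝒜) :=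
  ⋃ (g : FinRelevant 𝒜) (h : g.carrier ⊆ f), Set.range (specPotionMap (𝒜 := 𝒜) h ≫ chart g)

/-- For `f` finite relevant, `U_f` is the image of its chart. -/
theorem piece_eq_range_chart (f : FinRelevant 𝒜) :
    piece 𝒜 f.carrier = Set.range (chart f) := by
  apply Set.Subset.antisymm
  · refine Set.iUnion₂_subset fun g h ↦ ?_
    rw [specPotionMap_chart (f := g) (g := f) h]
  · refine Set.Subset.trans ?_ (Set.subset_iUnion₂ f (Set.Subset.refl f.carrier))
    rw [specPotionMap_chart (le_refl f)]

end Proj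

section TildeComap

open TopologicalSpace StructureSheaf

theorem comapFun_smul {R S : Type u} [CommRing R] [CommRing S] {N P : Type u} [AddCommGroup N]
    [Module R N] [AddCommGroup P] [Module S P] {σ : R →+* S} (p : N →ₛₗ[σ] P)
    (y : PrimeSpectrum.Top S) (a : Localizations R (PrimeSpectrum.comap σ y))
    (z : Localizations N (PrimeSpectrum.comap σ y)) :
    Localizations.comapFun p y (a • z) =
      Localizations.comapFun σ.toSemilinearMap y a • Localizations.comapFun p y z := by
  induction a using LocalizedModule.induction_on with | h a s =>
  induction z using LocalizedModule.induction_on with | h z t =>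
  refine (congr_arg (Localizations.comapFun p y) (LocalizedModule.mk_smul_mk a z s t)).trans ?_
  refine (Localizations.comapFun_mk p y (a • z) (s * t)).trans ?_
  refine Eq.trans ?_ (congr_arg₂ (· • ·)
    (Localizations.comapFun_mk σ.toSemilinearMap y a s).symm
    (Localizations.comapFun_mk p y z t).symm)
  refine Eq.trans ?_ (LocalizedModule.mk_smul_mk (σ a) (p z) ⟨σ s.1, s.2⟩ ⟨σ t.1, t.2⟩).symm
  rw [map_smulₛₗ]
  congr 1
  exact Subtype.ext (map_mul σ s.1 t.1)

variable {R S : CommRingCat.{u}} (φ : R ⟶ S) {N : ModuleCat.{u} R} {P : ModuleCat.{u} S}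

/-- A semilinear map `N → P` over `φ : R ⟶ S` induces a morphism from the sheaf of modules on
`Spec R` associated with `N` to the direct image of the one associated with `P`. On sections it
sends `n / r` to `p n / φ r`. -/
def tildeComap (p : N →ₛₗ[φ.hom] P) :
    tilde N ⟶ (Scheme.Modules.pushforward (Spec.map φ)).obj (tilde P) where
  val := PresheafOfModules.homMk
    { app U := AddCommGrpCat.ofHom
        (comapₗ p U.unop ((Opens.map (Spec.map φ).base).obj U.unop) (Set.Subset.refl _)).toAddMonoidHom
      naturality _ _ _ := rfl }
    (fun _ _ _ ↦ Subtype.ext (funext fun y ↦ comapFun_smul p y.1 _ _))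

theorem tildeComap_app (p : N →ₛₗ[φ.hom] P) (U : (Spec R).Opens) (s : Γ(tilde N, U)) :
  (tildeComap φ p).app U s =
    (comapₗ p U ((Opens.map (Spec.map φ).base).obj U) (Set.Subset.refl _)) s := rfl

end TildeComap

section Modules

variable {M A : Type u} [AddCommGroup M] [DecidableEq M] [CommRing A]
  (𝒜 : M → AddSubgroup A) [GradedRing 𝒜]
  {Q : Type u} [AddCommGroup Q] [Module A Q] (𝒬 : M → AddSubgroup Q) [SetLike.GradedSMul 𝒜 𝒬]

/-- The degree zero part of the localization of the graded module `Q` at `S`: the fractions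
`q / s` with `q` and `s` homogeneous of the same degree. -/
def degreeZeroPart (S : Submonoid A) : AddSubgroup (LocalizedModule S Q) where
  carrier := {z | ∃ i, ∃ q ∈ 𝒬 i, ∃ s : S, (s : A) ∈ 𝒜 i ∧ z = LocalizedModule.mk q s}
  zero_mem' := ⟨0, 0, zero_mem _, 1, SetLike.GradedOne.one_mem, by simp⟩
  add_mem' := by
    rintro _ _ ⟨i, q, hq, s, hs, rfl⟩ ⟨j, r, hr, t, ht, rfl⟩
    refine ⟨i + j, _, add_mem ?_ ?_, s * t, SetLike.GradedMul.mul_mem hs ht,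
      LocalizedModule.mk_add_mk⟩
    · rw [add_comm]
      exact SetLike.GradedSMul.smul_mem ht hq
    · exact SetLike.GradedSMul.smul_mem hs hr
  neg_mem' := by
    rintro _ ⟨i, q, hq, s, hs, rfl⟩
    exact ⟨i, -q, neg_mem hq, s, hs, (LocalizedModule.mk_neg).symm⟩

theorem val_smul_mem (S : Submonoid A) (r : HomogeneousLocalization 𝒜 S)
    {z : LocalizedModule S Q} (hz : z ∈ degreeZeroPart 𝒜 𝒬 S) :
    r.val • z ∈ degreeZeroPart 𝒜 𝒬 S := by
  obtain ⟨⟨d, ⟨x, hx⟩, ⟨t, ht⟩, htS⟩, rfl⟩ := HomogeneousLocalization.mk_surjective r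
  obtain ⟨i, q, hq, s, hs, rfl⟩ := hz
  rw [HomogeneousLocalization.val_mk, LocalizedModule.mk_smul_mk]
  exact ⟨d + i, x • q, SetLike.GradedSMul.smul_mem hx hq, _, SetLike.GradedMul.mul_mem ht hs, rfl⟩

instance (S : Submonoid A) : Module (HomogeneousLocalization 𝒜 S) (degreeZeroPart 𝒜 𝒬 S) where
  smul r z := ⟨r.val • z.1, val_smul_mem 𝒜 𝒬 S r z.2⟩
  one_smul z := Subtype.ext (by
    change HomogeneousLocalization.val 1 • z.1 = z.1
    rw [HomogeneousLocalization.val_one, one_smul])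
  mul_smul r r' z := Subtype.ext (by
    change HomogeneousLocalization.val (r * r') • z.1 = r.val • r'.val • z.1
    rw [HomogeneousLocalization.val_mul, mul_smul])
  smul_zero r := Subtype.ext (smul_zero r.val)
  smul_add r z z' := Subtype.ext (smul_add r.val z.1 z'.1)
  add_smul r r' z := Subtype.ext (by
    change HomogeneousLocalization.val (r + r') • z.1 = r.val • z.1 + r'.val • z.1
    rw [HomogeneousLocalization.val_add, add_smul])
  zero_smul z := Subtype.ext (by
    change HomogeneousLocalization.val 0 • z.1 = 0
    rw [HomogeneousLocalization.val_zero, zero_smul])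

/-- The `A_(f)`-module `Q_(f)`. -/
abbrev modulePotion (f : Set A) : Type u := degreeZeroPart 𝒜 𝒬 (Submonoid.closure f)

theorem liftOfLE_mk {S T : Submonoid A} (h : S ≤ T) (q : Q) (s : S) :
    LocalizedModule.liftOfLE S T h (LocalizedModule.mk q s) =
      LocalizedModule.mk q ⟨s.1, h s.2⟩ := by
  rw [IsLocalizedModule.mk_eq_mk' s q, IsLocalizedModule.mk_eq_mk' ⟨s.1, h s.2⟩ q]
  exact IsLocalizedModule.liftOfLE_mk' _ _ _ _ _ _ _

/-- The canonical map `Q_(f) → Q_(g)`, `q / s ↦ q / s`, for `f ⊆ g`. -/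
def modulePotionMap {f g : Set A} (h : f ⊆ g) :
    modulePotion 𝒜 𝒬 f →ₛₗ[potionMap 𝒜 h] modulePotion 𝒜 𝒬 g where
  toFun z := ⟨LocalizedModule.liftOfLE _ _ (Submonoid.closure_mono h) z.1, by
    obtain ⟨_, i, q, hq, s, hs, rfl⟩ := z
    exact ⟨i, q, hq, ⟨s, Submonoid.closure_mono h s.2⟩, hs, liftOfLE_mk _ q s⟩⟩
  map_add' z z' := Subtype.ext (map_add _ z.1 z'.1)
  map_smul' r z := by
    obtain ⟨c, rfl⟩ := HomogeneousLocalization.mk_surjective r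
    obtain ⟨_, i, q, hq, s, hs, rfl⟩ := z
    refine Subtype.ext ?_
    change LocalizedModule.liftOfLE _ _ (Submonoid.closure_mono h)
      ((HomogeneousLocalization.mk c).val • LocalizedModule.mk q s) =
      (potionMap 𝒜 h (HomogeneousLocalization.mk c)).val •
        LocalizedModule.liftOfLE _ _ (Submonoid.closure_mono h) (LocalizedModule.mk q s)
    rw [val_potionMap_mk, HomogeneousLocalization.val_mk, LocalizedModule.mk_smul_mk,
      liftOfLE_mk, liftOfLE_mk, LocalizedModule.mk_smul_mk]
    rfl

/-- The direct image on `Proj A` of the sheaf on `U_f` associated with the `A_(f)`-module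
`Q_(f)`. -/
def chartSheaf (f : FinRelevant 𝒜) : (Proj 𝒜).Modules :=
  (Scheme.Modules.pushforward (chart f)).obj
    (tilde (R := CommRingCat.of (potion 𝒜 f.carrier))
      (ModuleCat.of (potion 𝒜 f.carrier) (modulePotion 𝒜 𝒬 f.carrier)))

/-- The canonical map between the direct images on `Proj A` of the sheaves on `U_f` and on
`U_g ⊆ U_f`, for `f ⊆ g`, induced by `Q_(f) → Q_(g)`. -/
def chartSheafMap {f g : FinRelevant 𝒜} (h : f ≤ g) : chartSheaf 𝒜 𝒬 f ⟶ chartSheaf 𝒜 𝒬 g :=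
  (Scheme.Modules.pushforward (chart f)).map
      (tildeComap (CommRingCat.ofHom (potionMap 𝒜 (f := f.carrier) (g := g.carrier) h))
        (N := ModuleCat.of (potion 𝒜 f.carrier) (modulePotion 𝒜 𝒬 f.carrier))
        (P := ModuleCat.of (potion 𝒜 g.carrier) (modulePotion 𝒜 𝒬 g.carrier))
        (modulePotionMap 𝒜 𝒬 (f := f.carrier) (g := g.carrier) h)) ≫
    (Scheme.Modules.pushforwardComp (specPotionMap h) (chart f)).hom.app _ ≫
    (Scheme.Modules.pushforwardCongr (specPotionMap_chart h)).hom.app _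

theorem chartSheafMap_app_apply {f g : FinRelevant 𝒜} (h : f ≤ g) (U : (Proj 𝒜).Opens)
    (s : Γ(chartSheaf 𝒜 𝒬 f, U)) (y : chart g ⁻¹ᵁ U) (hy : specPotionMap h y.1 ∈ chart f ⁻¹ᵁ U) :
    ((chartSheafMap 𝒜 𝒬 h).app U s).1 y =
      StructureSheaf.Localizations.comapFun
        (modulePotionMap 𝒜 𝒬 (f := f.carrier) (g := g.carrier) h) y.1
        (s.1 ⟨specPotionMap h y.1, hy⟩) := rfl

theorem specPotionMap_mem {f g : FinRelevant 𝒜} (h : f ≤ g) (U : (Proj 𝒜).Opens)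
    (y : chart g ⁻¹ᵁ U) : specPotionMap (𝒜 := 𝒜) h y.1 ∈ chart f ⁻¹ᵁ U := by
  have : chart f (specPotionMap (𝒜 := 𝒜) h y.1) = chart g y.1 := 
    congr($(specPotionMap_chart h) y.1)
  change chart f (specPotionMap (𝒜 := 𝒜) h y.1) ∈ U
  rw [this]
  exact y.2

theorem potionMap_refl {f : Set A} (h : f ⊆ f) (x : potion 𝒜 f) : potionMap 𝒜 h x = x := by
  obtain ⟨c, rfl⟩ := HomogeneousLocalization.mk_surjective x
  rfl

theorem potionMap_potionMap {f g k : Set A} (h : f ⊆ g) (h' : g ⊆ k) (x : potion 𝒜 f) :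
    potionMap 𝒜 h' (potionMap 𝒜 h x) = potionMap 𝒜 (h.trans h') x := by
  obtain ⟨c, rfl⟩ := HomogeneousLocalization.mk_surjective x
  rfl

theorem modulePotionMap_refl {f : Set A} (h : f ⊆ f) (x : modulePotion 𝒜 𝒬 f) :
    modulePotionMap 𝒜 𝒬 h x = x := by
  obtain ⟨_, i, q, hq, s, hs, rfl⟩ := x
  exact Subtype.ext (liftOfLE_mk _ _ _)

theorem modulePotionMap_modulePotionMap {f g k : Set A} (h : f ⊆ g) (h' : g ⊆ k)
    (x : modulePotion 𝒜 𝒬 f) :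
    modulePotionMap 𝒜 𝒬 h' (modulePotionMap 𝒜 𝒬 h x) =
      modulePotionMap 𝒜 𝒬 (h.trans h') x := by
  obtain ⟨_, i, q, hq, s, hs, rfl⟩ := x
  refine Subtype.ext ?_
  change LocalizedModule.liftOfLE _ _ _ (LocalizedModule.liftOfLE _ _ _ _) =
    LocalizedModule.liftOfLE _ _ _ _
  rw [liftOfLE_mk, liftOfLE_mk, liftOfLE_mk]

theorem chartSheafMap_refl {f : FinRelevant 𝒜} (h : f ≤ f) :
    chartSheafMap 𝒜 𝒬 h = 𝟙 (chartSheaf 𝒜 𝒬 f) := by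
  ext U s
  refine Subtype.ext (funext fun y ↦ ?_)
  have hy := specPotionMap_mem 𝒜 h U y
  refine (chartSheafMap_app_apply 𝒜 𝒬 h U s y hy).trans ?_
  have hy' : specPotionMap (𝒜 := 𝒜) (f := f.carrier) h y.1 = y.1 := by
    refine PrimeSpectrum.ext (Ideal.ext fun x ↦ ?_)
    change potionMap 𝒜 h x ∈ y.1.asIdeal ↔ x ∈ y.1.asIdeal
    rw [potionMap_refl]
  obtain ⟨V, hV, i, n, r, hr⟩ := s.2 y
  obtain ⟨h1, e1⟩ := hr ⟨y.1, hV⟩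
  obtain ⟨h2, e2⟩ := hr ⟨specPotionMap (𝒜 := 𝒜) h y.1, by rw [hy']; exact hV⟩
  refine (congr_arg _ e2).trans (Eq.trans ?_ e1.symm)
  refine (StructureSheaf.Localizations.comapFun_mk _ y.1 n ⟨r, h2⟩).trans ?_
  congr 1
  · exact modulePotionMap_refl 𝒜 𝒬 h n
  · exact Subtype.ext (potionMap_refl 𝒜 h r)

theorem chartSheafMap_comp {f g k : FinRelevant 𝒜} (h : f ≤ g) (h' : g ≤ k) :
    chartSheafMap 𝒜 𝒬 h ≫ chartSheafMap 𝒜 𝒬 h' = chartSheafMap 𝒜 𝒬 (h.trans h') := by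
  ext U s
  refine Subtype.ext (funext fun y ↦ ?_)
  have hy := specPotionMap_mem 𝒜 h' U y
  have hy2 := specPotionMap_mem 𝒜 h U ⟨_, hy⟩
  have hy3 := specPotionMap_mem 𝒜 (h.trans h') U y
  have hy' : specPotionMap (𝒜 := 𝒜) (h.trans h') y.1 =
      specPotionMap (𝒜 := 𝒜) h (specPotionMap (𝒜 := 𝒜) h' y.1) := by
    refine PrimeSpectrum.ext (Ideal.ext fun x ↦ ?_)
    change potionMap 𝒜 (h.trans h') x ∈ y.1.asIdeal ↔
      potionMap 𝒜 h' (potionMap 𝒜 h x) ∈ y.1.asIdeal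
    rw [potionMap_potionMap]
  obtain ⟨V, hV, i, n, r, hr⟩ := s.2 ⟨_, hy2⟩
  obtain ⟨h1, e1⟩ := hr ⟨_, hV⟩
  obtain ⟨h2, e2⟩ := hr ⟨specPotionMap (𝒜 := 𝒜) (h.trans h') y.1, by rw [hy']; exact hV⟩
  have L : (((chartSheafMap 𝒜 𝒬 h ≫ chartSheafMap 𝒜 𝒬 h').app U) s).1 y =
      LocalizedModule.mk (modulePotionMap 𝒜 𝒬 h' (modulePotionMap 𝒜 𝒬 h n))
        ⟨potionMap 𝒜 h' (potionMap 𝒜 h r), h1⟩ := by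
    refine (chartSheafMap_app_apply 𝒜 𝒬 h' U ((chartSheafMap 𝒜 𝒬 h).app U s) y hy).trans ?_
    refine (congr_arg _ (chartSheafMap_app_apply 𝒜 𝒬 h U s ⟨_, hy⟩ hy2)).trans ?_
    refine (congr_arg _ (congr_arg _ e1)).trans ?_
    refine (congr_arg _ (StructureSheaf.Localizations.comapFun_mk _ _ n ⟨r, h1⟩)).trans ?_
    exact StructureSheaf.Localizations.comapFun_mk _ y.1 _ ⟨_, h1⟩
  have R : ((chartSheafMap 𝒜 𝒬 (h.trans h')).app U s).1 y =
      LocalizedModule.mk (modulePotionMap 𝒜 𝒬 (h.trans h') n)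
        ⟨potionMap 𝒜 (h.trans h') r, h2⟩ := by
    refine (chartSheafMap_app_apply 𝒜 𝒬 (h.trans h') U s y hy3).trans ?_
    refine (congr_arg _ e2).trans ?_
    exact StructureSheaf.Localizations.comapFun_mk _ y.1 _ ⟨_, h2⟩
  refine L.trans (Eq.trans ?_ R.symm)
  congr 1
  · exact modulePotionMap_modulePotionMap 𝒜 𝒬 h h' n
  · exact Subtype.ext (potionMap_potionMap 𝒜 h h' r)

/-- The diagram of the direct images of the sheaves associated with the `Q_(f)`. -/
def chartSheafFunctor : FinRelevant 𝒜 ⥤ (Proj 𝒜).Modules where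
  obj f := chartSheaf 𝒜 𝒬 f
  map h := chartSheafMap 𝒜 𝒬 (leOfHom h)
  map_id _ := chartSheafMap_refl 𝒜 𝒬 le_rfl
  map_comp h h' := (chartSheafMap_comp 𝒜 𝒬 (leOfHom h) (leOfHom h')).symm

/-- The sheaf of modules on `Proj A` associated with the graded `A`-module `Q`, obtained by gluing
the sheaves on the charts `U_f` associated with the modules `Q_(f)`: its sections on `U` are the
families of sections, on the `U ∩ U_f`, of the sheaves associated with the `Q_(f)`, which correspond
to each other under the canonical maps `Q_(f) → Q_(g)` for `f ⊆ g`. -/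
def sheafOfGradedModule : (Proj 𝒜).Modules := Limits.limit (chartSheafFunctor 𝒜 𝒬)

end Modules

section Twist

variable {M A : Type u} [AddCommGroup M] [DecidableEq M] [CommRing A]
  (𝒜 : M → AddSubgroup A) [GradedRing 𝒜]
  {Q : Type u} [AddCommGroup Q] [Module A Q]

/-- The shifted grading `Q(α)_β = Q_{α + β}`. -/
def twist (𝒬 : M → AddSubgroup Q) (α : M) : M → AddSubgroup Q := fun β ↦ 𝒬 (α + β)

instance (𝒬 : M → AddSubgroup Q) [SetLike.GradedSMul 𝒜 𝒬] (α : M) :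
    SetLike.GradedSMul 𝒜 (twist 𝒬 α) where
  smul_mem i j a q ha hq := by
    have : a • q ∈ 𝒬 (i +ᵥ (α + j)) := SetLike.GradedSMul.smul_mem ha hq
    rwa [vadd_eq_add, add_left_comm] at this

/-- The twisting sheaf `O_X(α)` on `X = Proj A`: the sheaf associated with `A(α)`. -/
def twistingSheaf (α : M) : (Proj 𝒜).Modules := sheafOfGradedModule 𝒜 (twist 𝒜 α)

end Twist

/-- An `O_X`-module is invertible if it is locally isomorphic to `O_X`. -/
def IsInvertible {X : Scheme.{u}} (L : X.Modules) : Prop :=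
  ∀ x : X, ∃ U : X.Opens, x ∈ U ∧
    Nonempty (L.restrict U.ι ≅ SheafOfModules.unit (U : Scheme.{u}).ringCatSheaf)

end GradedProj

end

/-!
Let `f` be a finite relevant family with `M_f = M`. Every degree `α` is then the degree of a
fraction `s / t` of products of members of `f`, and `s / t` is a unit after inverting `f`;
multiplication by it is an isomorphism `A_(f) ≅ A(α)_(f)`
(`exists_linearEquiv_modulePotion_twist`). So the sheaf on `U_f` associated with `A(α)_(f)` is the
structure sheaf.

The sheaf associated with a graded module `Q` is a limit of direct images from all charts, so it
has to be shown that over `U_g` it is the sheaf associated with `Q_(g)`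
(`sheafOfGradedModuleRestrictChart`). For `f ⊆ h` with `h` finite, `A_(h)` and `Q_(h)` are the
localizations of `A_(f)` and `Q_(f)` at one element `w`; hence the sheaves on `U_f` and `U_h` have
the same sections over open subsets of `D(w) = U_h` (`StructureSheaf.comapₗ_bijective`,
`isIso_chartSheafMap_app`). For an open `V ⊆ U_g` this applies to `h = f ∪ g`, because `V ∩ U_f =
V ∩ U_{f ∪ g}`, and it forces a compatible family of sections over `V` to be determined by its
member at `g`, which is arbitrary (`IsLimit.isIso_π_app_of_monotone`).

Finally, since `M` is finitely generated, every point of `U_f`, for `f` relevant with `M_f = M`,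
lies in the chart of a finite relevant subfamily with the same property
(`exists_chart_degreeGroup_eq_top`). The assumption on `F` thus covers `Proj A` by charts on which
the twisting sheaf is trivial.
-/

/-! ### A limit attained at one index -/

namespace CategoryTheory.Limits.IsLimit

/-- If every `D j ⟶ D (k j)` is an isomorphism, where `k` is monotone and `k j` lies above `j` and
above a fixed `g`, then the limit of `D` is `D g`. The inverse of the projection is given by the
cone whose leg at `j` is `D g ⟶ D (k j)` followed by the inverse of `D j ⟶ D (k j)`. -/
theorem isIso_π_app_of_monotone {J : Type*} [Preorder J] {C : Type*} [Category* C] {D : J ⥤ C}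
    {c : Cone D} (hc : IsLimit c) (g : J) (k : J →o J) (hk : ∀ j, j ≤ k j) (hg : ∀ j, g ≤ k j)
    (hD : ∀ j, IsIso (D.map (homOfLE (hk j)))) : IsIso (c.π.app g) := by
  let s : Cone D :=
    { pt := D.obj g
      π :=
        { app j := D.map (homOfLE (hg j)) ≫ inv (D.map (homOfLE (hk j)))
          naturality i j f := by
            have hij : i ≤ j := leOfHom f
            have h₁ : D.map (homOfLE (hk i)) ≫ D.map (homOfLE (k.monotone hij)) =
                D.map f ≫ D.map (homOfLE (hk j)) := by
              rw [← D.map_comp, ← D.map_comp]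
              rfl
            have h₂ : D.map (homOfLE (hg i)) ≫ D.map (homOfLE (k.monotone hij)) =
                D.map (homOfLE (hg j)) := by
              rw [← D.map_comp]
              rfl
            rw [← cancel_mono (D.map (homOfLE (hk j)))]
            simp [← h₁, h₂] } }
  refine ⟨hc.lift s, hc.hom_ext fun j ↦ ?_, ?_⟩
  · rw [Category.assoc, hc.fac, Category.id_comp]
    change c.π.app g ≫ D.map (homOfLE (hg j)) ≫ inv (D.map (homOfLE (hk j))) = c.π.app j
    rw [← Category.assoc, c.w, IsIso.comp_inv_eq, c.w]
  · rw [hc.fac]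
    exact IsIso.hom_inv_id (D.map (homOfLE (hk g)))

end CategoryTheory.Limits.IsLimit

/-! ### Sections over a basic open set -/

namespace AlgebraicGeometry.StructureSheaf

open TopologicalSpace

variable {R S : Type u} [CommRing R] [CommRing S] {N P : Type u} [AddCommGroup N] [Module R N]
  [AddCommGroup P] [Module S P] {σ : R →+* S} {p : N →ₛₗ[σ] P} {w : R}

/-- Injectivity on stalks: the hypotheses say that `S` is generated over `R` by inverse powers
of `w` and that the kernel of `p` is `w`-power torsion. -/
theorem Localizations.comapFun_injective (hw : IsUnit (σ w))
    (hσ : ∀ s, ∃ n r, σ w ^ n * s = σ r) (hp : ∀ n, p n = 0 → ∃ m, w ^ m • n = 0)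
    (y : PrimeSpectrum S) : Function.Injective (Localizations.comapFun p y) := by
  have hwy : w ∉ (PrimeSpectrum.comap σ y).asIdeal := fun h ↦
    y.isPrime.ne_top (Ideal.eq_top_of_isUnit_mem _ h hw)
  rw [injective_iff_map_eq_zero]
  intro z hz
  induction z using LocalizedModule.induction_on with | h n r =>
  replace hz := (Localizations.comapFun_mk p y n r).symm.trans hz
  rw [← LocalizedModule.zero_mk 1, LocalizedModule.mk_eq] at hz
  obtain ⟨b, hb⟩ := hz
  simp only [one_smul, smul_zero, Submonoid.smul_def] at hb
  obtain ⟨i, r', hr'⟩ := hσ b.1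
  have hr'y : r' ∉ (PrimeSpectrum.comap σ y).asIdeal := by
    change σ r' ∉ y.asIdeal
    rw [← hr']
    exact y.asIdeal.primeCompl.mul_mem (pow_mem (S := y.asIdeal.primeCompl) hwy i) b.2
  have h0 : p (r' • n) = 0 := by
    rw [map_smulₛₗ, ← hr', mul_smul, hb, smul_zero]
  obtain ⟨m, hm⟩ := hp _ h0
  rw [← LocalizedModule.zero_mk 1, LocalizedModule.mk_eq]
  refine ⟨⟨w ^ m * r', ?_⟩, ?_⟩
  · exact (PrimeSpectrum.comap σ y).asIdeal.primeCompl.mul_mem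
      (pow_mem (S := (PrimeSpectrum.comap σ y).asIdeal.primeCompl) hwy m) hr'y
  · simp only [one_smul, smul_zero, Submonoid.smul_def]
    rw [mul_smul, hm]

/-- A fraction over `S` with numerator in `P` equals one whose numerator and denominator come from
`N` and `R`, uniformly in the point at which it is considered. -/
theorem exists_comapFun_mk_eq (hw : IsUnit (σ w)) (hσ : ∀ s, ∃ n r, σ w ^ n * s = σ r)
    (hp : ∀ q, ∃ m n, σ w ^ m • q = p n) (q : P) (b : S) :
    ∃ (n : N) (r : R), ∀ (y : PrimeSpectrum S) (hb : b ∉ y.asIdeal),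
      ∃ hr : r ∉ (PrimeSpectrum.comap σ y).asIdeal,
        Localizations.comapFun p y (LocalizedModule.mk n ⟨r, hr⟩) =
          LocalizedModule.mk q ⟨b, hb⟩ := by
  obtain ⟨i, r, hr⟩ := hσ b
  obtain ⟨j, n, hn⟩ := hp q
  refine ⟨w ^ i • n, w ^ j * r, fun y hb ↦ ?_⟩
  have hwy : σ w ∈ y.asIdeal.primeCompl := fun h ↦
    y.isPrime.ne_top (Ideal.eq_top_of_isUnit_mem _ h hw)
  refine ⟨?_, ?_⟩
  · change σ (w ^ j * r) ∉ y.asIdeal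
    rw [map_mul, map_pow, ← hr]
    exact mul_mem (pow_mem hwy j) (y.asIdeal.primeCompl.mul_mem (pow_mem hwy i) hb)
  · refine (Localizations.comapFun_mk p y _ _).trans ?_
    refine LocalizedModule.mk_eq.mpr ⟨1, ?_⟩
    simp only [one_smul, map_smulₛₗ, map_pow, ← hn, Submonoid.smul_def, map_mul, ← hr, smul_smul]
    congr 1
    ring

/-- If `S` is the localization of `R` at `w` and `P` is the localization of `N` at `w`, then a
section of the sheaf of `N` on an open subset of `D(w)` is the same as a section of the sheaf of
`P` on its preimage. -/
theorem comapₗ_bijective (hS : letI := σ.toAlgebra; IsLocalization.Away w S)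
    (hp : ∀ q, ∃ m n, σ w ^ m • q = p n) (hp' : ∀ n, p n = 0 → ∃ m, w ^ m • n = 0)
    (U : Opens (PrimeSpectrum.Top R)) (hU : U ≤ PrimeSpectrum.basicOpen w)
    (V : Opens (PrimeSpectrum.Top S)) (hV : V.1 = PrimeSpectrum.comap σ ⁻¹' U.1) :
    Function.Bijective (comapₗ p U V hV.subset) := by
  letI := σ.toAlgebra
  have hw : IsUnit (σ w) := IsLocalization.Away.algebraMap_isUnit (S := S) w
  have hσ (s : S) : ∃ n r, σ w ^ n * s = σ r := by
    obtain ⟨n, r, h⟩ := IsLocalization.Away.surj w s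
    exact ⟨n, r, by rw [mul_comm]; exact h⟩
  have hemb : Topology.IsOpenEmbedding (PrimeSpectrum.comap σ) :=
    PrimeSpectrum.localization_away_isOpenEmbedding S w
  have hrange (x : PrimeSpectrum R) (hx : x ∈ U) : ∃ y, PrimeSpectrum.comap σ y = x := by
    have : x ∈ Set.range (PrimeSpectrum.comap (algebraMap R S)) := by
      rw [PrimeSpectrum.localization_away_comap_range S w]
      exact hU hx
    exact this
  have hinj := Localizations.comapFun_injective (p := p) hw hσ hp'
  refine ⟨fun s t hst ↦ Subtype.ext (funext fun ⟨x, hx⟩ ↦ ?_), fun t ↦ ?_⟩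
  · obtain ⟨y, rfl⟩ := hrange x hx
    exact hinj y (congr_fun (congr_arg Subtype.val hst) ⟨y, hV.superset hx⟩)
  · have ht := t.2
    -- Points of `V` are points of `U`, so the stalkwise preimages of `t` form a function on `U`.
    -- The transport `h ▸ z` takes care of points that are only propositionally equal.
    have key (x : U) : ∃ z : Localizations N x.1, ∀ (y : PrimeSpectrum S)
        (h : x.1 = PrimeSpectrum.comap σ y) (hy : y ∈ V),
        Localizations.comapFun p y (h ▸ z) = t.1 ⟨y, hy⟩ := by
      obtain ⟨x, hx⟩ := x
      obtain ⟨y, rfl⟩ := hrange x hx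
      obtain ⟨W, hyW, i, q, b, hW⟩ := ht ⟨y, hV.superset hx⟩
      obtain ⟨n, r, hnr⟩ := exists_comapFun_mk_eq (p := p) hw hσ hp q b
      obtain ⟨hb, e⟩ := hW ⟨y, hyW⟩
      obtain ⟨hr, e'⟩ := hnr y hb
      refine ⟨LocalizedModule.mk n ⟨r, hr⟩, fun y' h hy' ↦ ?_⟩
      obtain rfl : y = y' := hemb.injective h
      exact e'.trans e.symm
    choose s hs using key
    refine ⟨⟨s, ?_⟩, Subtype.ext (funext fun ⟨y, hy⟩ ↦ hs ⟨_, hV.subset hy⟩ y rfl hy)⟩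
    -- The image of an open set on which `t` is a fraction is open, and `s` is a fraction on it.
    rintro ⟨x, hx⟩
    obtain ⟨y, rfl⟩ := hrange x hx
    obtain ⟨W, hyW, i, q, b, hW⟩ := ht ⟨y, hV.superset hx⟩
    obtain ⟨n, r, hnr⟩ := exists_comapFun_mk_eq (p := p) hw hσ hp q b
    have hle : ∀ z ∈ W, z ∈ V := fun z hz ↦ leOfHom i hz
    refine ⟨⟨_, hemb.isOpenMap _ W.2⟩, ⟨y, hyW, rfl⟩, homOfLE ?_, n, r, ?_⟩
    · rintro _ ⟨z, hz, rfl⟩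
      exact hV.subset (hle z hz)
    · rintro ⟨_, z, hz, rfl⟩
      obtain ⟨hb, e⟩ := hW ⟨z, hz⟩
      obtain ⟨hr, e'⟩ := hnr z hb
      refine ⟨hr, hinj z ?_⟩
      exact (hs ⟨_, hV.subset (hle z hz)⟩ z rfl (hle z hz)).trans (e.trans e'.symm)

end AlgebraicGeometry.StructureSheaf

namespace GradedProj

/-! ### Degree zero parts of localizations -/

section Algebra

variable {M A : Type u} [AddCommGroup M] [DecidableEq M] [CommRing A]
  {𝒜 : M → AddSubgroup A} [GradedRing 𝒜]

/-- For `f ⊆ g` the module `Q_(g)` is the localization of `Q_(f)` at `w`; here, every element of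
`Q_(g)` lifts after multiplication by a power of `w`. -/
theorem IsLocElement.modulePotionMap_surj {Q : Type u} [AddCommGroup Q] [Module A Q]
    (𝒬 : M → AddSubgroup Q) [SetLike.GradedSMul 𝒜 𝒬] {f g : Set A} (h : f ⊆ g) {P : A}
    (hP : ∀ s ∈ Submonoid.closure g, ∃ N : ℕ, s ∣ P ^ N) {w : potion 𝒜 f}
    (hw : IsLocElement f P w) (z : modulePotion 𝒜 𝒬 g) :
    ∃ (N : ℕ) (y : modulePotion 𝒜 𝒬 f),
      potionMap 𝒜 h w ^ N • z = modulePotionMap 𝒜 𝒬 h y := by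
  obtain ⟨n, hn, c, -, -, j, hj, s, hs, hsf, rfl⟩ := hw
  obtain ⟨_, i, q, hq, ⟨t, htg⟩, ht, rfl⟩ := z
  obtain ⟨N, hN⟩ := hP t htg
  have hdvd : t ∣ (P ^ n * c) ^ N := by
    rw [mul_pow, ← pow_mul]
    exact (hN.trans (pow_dvd_pow _ (Nat.le_mul_of_pos_left _ hn))).mul_right _
  obtain ⟨e, he, heq⟩ := exists_homogeneous_cofactor ht (SetLike.pow_mem_graded N hj) hdvd
  have heq' : e • q ∈ 𝒬 (N • j) := by
    have := SetLike.GradedSMul.smul_mem he hq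
    rwa [vadd_eq_add, sub_add_cancel] at this
  refine ⟨N, ⟨_, N • j, e • q, heq', ⟨s ^ N, pow_mem hsf N⟩, SetLike.pow_mem_graded N hs, rfl⟩,
    Subtype.ext ?_⟩
  change (potionMap 𝒜 h (HomogeneousLocalization.mk _) ^ N).val • LocalizedModule.mk q _ =
    LocalizedModule.liftOfLE _ _ (Submonoid.closure_mono h) (LocalizedModule.mk _ _)
  rw [liftOfLE_mk, HomogeneousLocalization.val_pow, val_potionMap_mk, Localization.mk_pow,
    LocalizedModule.mk_smul_mk, LocalizedModule.mk_eq]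
  refine ⟨1, ?_⟩
  simp only [one_smul, Submonoid.smul_def, Submonoid.coe_mul, SubmonoidClass.mk_pow, smul_smul,
    ← heq]
  congr 1
  ring

/-- The kernel of `Q_(f) → Q_(g)` is killed by powers of `w`. -/
theorem IsLocElement.exists_pow_smul_eq_zero {Q : Type u} [AddCommGroup Q] [Module A Q]
    (𝒬 : M → AddSubgroup Q) [SetLike.GradedSMul 𝒜 𝒬] {f g : Set A} (h : f ⊆ g) {P : A}
    (hP : ∀ s ∈ Submonoid.closure g, ∃ N : ℕ, s ∣ P ^ N) {w : potion 𝒜 f}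
    (hw : IsLocElement f P w) (z : modulePotion 𝒜 𝒬 f) (hz : modulePotionMap 𝒜 𝒬 h z = 0) :
    ∃ N : ℕ, w ^ N • z = 0 := by
  obtain ⟨n, hn, c, -, -, j, hj, s, hs, hsf, rfl⟩ := hw
  obtain ⟨_, i, q, hq, ⟨t, htf⟩, ht, rfl⟩ := z
  replace hz : LocalizedModule.liftOfLE _ _ (Submonoid.closure_mono h)
      (LocalizedModule.mk q ⟨t, htf⟩) = 0 := congr_arg Subtype.val hz
  rw [liftOfLE_mk, ← LocalizedModule.zero_mk 1, LocalizedModule.mk_eq] at hz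
  obtain ⟨⟨τ, hτ⟩, h0⟩ := hz
  simp only [one_smul, smul_zero, Submonoid.smul_def] at h0
  obtain ⟨N, hN⟩ := hP τ hτ
  have hdvd : τ ∣ (P ^ n * c) ^ N := by
    rw [mul_pow, ← pow_mul]
    exact (hN.trans (pow_dvd_pow _ (Nat.le_mul_of_pos_left _ hn))).mul_right _
  obtain ⟨e, he⟩ := hdvd
  refine ⟨N, Subtype.ext ?_⟩
  change (HomogeneousLocalization.mk _ ^ N).val • LocalizedModule.mk q _ = 0
  rw [HomogeneousLocalization.val_pow, HomogeneousLocalization.val_mk, Localization.mk_pow,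
    LocalizedModule.mk_smul_mk]
  change LocalizedModule.mk ((P ^ n * c) ^ N • q) _ = 0
  rw [he, mul_comm, mul_smul, h0, smul_zero, LocalizedModule.zero_mk]

/-- An element of the group generated by the degrees of the members of `f` is the degree of a
fraction of products of members of `f`. -/
theorem exists_mem_closure_of_mem_degreeGroup {f : Set A} {α : M} (hα : α ∈ degreeGroup 𝒜 f) :
    ∃ i, ∃ s ∈ Submonoid.closure f, ∃ t ∈ Submonoid.closure f, s ∈ 𝒜 (α + i) ∧ t ∈ 𝒜 i := by
  induction hα using AddSubgroup.closure_induction with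
  | mem m hm =>
    obtain ⟨a, haf, -, ha⟩ := hm
    exact ⟨0, a, Submonoid.subset_closure haf, 1, one_mem _, by simpa using ha,
      SetLike.GradedOne.one_mem⟩
  | zero =>
    exact ⟨0, 1, one_mem _, 1, one_mem _, by simpa using SetLike.GradedOne.one_mem,
      SetLike.GradedOne.one_mem⟩
  | add x y _ _ hx hy =>
    obtain ⟨i, s, hs, t, ht, hsi, hti⟩ := hx
    obtain ⟨j, s', hs', t', ht', hsj, htj⟩ := hy
    refine ⟨i + j, s * s', mul_mem hs hs', t * t', mul_mem ht ht', ?_,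
      SetLike.GradedMul.mul_mem hti htj⟩
    rw [add_add_add_comm]
    exact SetLike.GradedMul.mul_mem hsi hsj
  | neg x _ hx =>
    obtain ⟨i, s, hs, t, ht, hsi, hti⟩ := hx
    exact ⟨x + i, t, ht, s, hs, by simpa using hti, hsi⟩

/-- If the degrees of the members of `f` generate `M`, then `A(α)_(f)` is free of rank one over
`A_(f)`: a basis is a fraction `s / t` of degree `α` of products of members of `f`, with inverse
`t / s`. -/
theorem exists_linearEquiv_modulePotion_twist {f : Set A} (hf : degreeGroup 𝒜 f = ⊤) (α : M) :
    Nonempty (potion 𝒜 f ≃ₗ[potion 𝒜 f] modulePotion 𝒜 (twist 𝒜 α) f) := by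
  obtain ⟨i, s, hs, t, ht, hsi, hti⟩ :=
    exists_mem_closure_of_mem_degreeGroup (hf ▸ AddSubgroup.mem_top α)
  let u : modulePotion 𝒜 (twist 𝒜 α) f :=
    ⟨LocalizedModule.mk s ⟨t, ht⟩, i, s, hsi, ⟨t, ht⟩, hti, rfl⟩
  refine ⟨LinearEquiv.ofBijective (LinearMap.toSpanSingleton _ _ u) ⟨?_, ?_⟩⟩
  · rw [injective_iff_map_eq_zero]
    intro r hr
    obtain ⟨⟨d, ⟨x, hx⟩, ⟨b, hb⟩, hbf⟩, rfl⟩ := HomogeneousLocalization.mk_surjective r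
    replace hr : (HomogeneousLocalization.mk _).val • LocalizedModule.mk s ⟨t, ht⟩ = 0 :=
      congr_arg Subtype.val hr
    rw [HomogeneousLocalization.val_mk, LocalizedModule.mk_smul_mk, ← LocalizedModule.zero_mk 1,
      LocalizedModule.mk_eq] at hr
    obtain ⟨⟨τ, hτ⟩, h0⟩ := hr
    simp only [one_smul, smul_zero, Submonoid.smul_def, smul_eq_mul] at h0
    apply HomogeneousLocalization.val_injective
    rw [HomogeneousLocalization.val_mk, HomogeneousLocalization.val_zero,
      ← Localization.mk_zero 1, Localization.mk_eq_mk_iff, Localization.r_iff_exists]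
    refine ⟨⟨τ * s, mul_mem hτ hs⟩, ?_⟩
    simp only [Submonoid.coe_one, one_mul, mul_zero]
    linear_combination h0
  · rintro ⟨_, j, q, hq, ⟨b, hb⟩, hbj, rfl⟩
    refine ⟨HomogeneousLocalization.mk ⟨α + i + j, ⟨q * t, ?_⟩, ⟨s * b, ?_⟩, mul_mem hs hb⟩,
      Subtype.ext ?_⟩
    · rw [add_right_comm]
      exact SetLike.GradedMul.mul_mem (A := 𝒜) hq hti
    · exact SetLike.GradedMul.mul_mem hsi hbj
    · change (HomogeneousLocalization.mk _).val • LocalizedModule.mk s ⟨t, ht⟩ = _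
      rw [HomogeneousLocalization.val_mk, LocalizedModule.mk_smul_mk, LocalizedModule.mk_eq]
      refine ⟨1, ?_⟩
      simp only [one_smul, Submonoid.smul_def, Submonoid.coe_mul, smul_eq_mul]
      ring

theorem degreeGroup_mono {f g : Set A} (h : f ⊆ g) : degreeGroup 𝒜 f ≤ degreeGroup 𝒜 g :=
  AddSubgroup.closure_mono fun _ ⟨a, ha, ha'⟩ ↦ ⟨a, h ha, ha'⟩

/-- A finitely generated group of degrees is already generated by the degrees of finitely many
members of `f`. -/
theorem exists_finite_subset_degreeGroup_eq_top [AddGroup.FG M] {f : Set A}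
    (hf : degreeGroup 𝒜 f = ⊤) : ∃ f₀ ⊆ f, f₀.Finite ∧ degreeGroup 𝒜 f₀ = ⊤ := by
  have hmem (m : M) : ∃ f₀ ⊆ f, f₀.Finite ∧ m ∈ degreeGroup 𝒜 f₀ := by
    have hm : m ∈ degreeGroup 𝒜 f := hf ▸ AddSubgroup.mem_top m
    induction hm using AddSubgroup.closure_induction with
    | mem m hm =>
      obtain ⟨a, ha, ha'⟩ := hm
      exact ⟨{a}, by simpa using ha, Set.finite_singleton a,
        AddSubgroup.subset_closure ⟨a, rfl, ha'⟩⟩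
    | zero => exact ⟨∅, Set.empty_subset _, Set.finite_empty, zero_mem _⟩
    | add x y _ _ hx hy =>
      obtain ⟨k, hk, hkf, hxk⟩ := hx
      obtain ⟨l, hl, hlf, hyl⟩ := hy
      exact ⟨k ∪ l, Set.union_subset hk hl, hkf.union hlf,
        add_mem (degreeGroup_mono Set.subset_union_left hxk)
          (degreeGroup_mono Set.subset_union_right hyl)⟩
    | neg x _ hx =>
      obtain ⟨k, hk, hkf, hxk⟩ := hx
      exact ⟨k, hk, hkf, neg_mem hxk⟩
  obtain ⟨T, hT⟩ := (inferInstance : AddGroup.FG M).out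
  choose k hk hkf hmk using hmem
  refine ⟨⋃ m ∈ T, k m, Set.iUnion₂_subset fun m _ ↦ hk m,
    T.finite_toSet.biUnion fun m _ ↦ hkf m, ?_⟩
  rw [eq_top_iff, ← hT, AddSubgroup.closure_le]
  exact fun m hm ↦ degreeGroup_mono (Set.subset_biUnion_of_mem (u := k) hm) (hmk m)

end Algebra

/-! ### Sheaves of graded modules on the charts -/

section Geometry

/-- If `S` and `P` are the localizations of `R` and `N` at `w`, then `tilde N` agrees over `D(w)`
with the direct image of `tilde P`. -/
theorem isIso_tildeComap_app {R S : CommRingCat.{u}} (φ : R ⟶ S) {N : ModuleCat.{u} R}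
    {P : ModuleCat.{u} S} (p : N →ₛₗ[φ.hom] P) {w : R}
    (hS : letI := φ.hom.toAlgebra; IsLocalization.Away w S)
    (hp : ∀ q, ∃ m n, φ.hom w ^ m • q = p n) (hp' : ∀ n, p n = 0 → ∃ m, w ^ m • n = 0)
    (U : (Spec R).Opens) (hU : U ≤ PrimeSpectrum.basicOpen w) :
    IsIso ((tildeComap φ p).app U) := by
  rw [ConcreteCategory.isIso_iff_bijective]
  exact StructureSheaf.comapₗ_bijective hS hp hp' U hU
    ((TopologicalSpace.Opens.map (Spec.map φ).base).obj U) rfl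

/-- The structural isomorphisms in `chartSheafMap` do not affect bijectivity on sections. -/
theorem isIso_pushforward_map_comp_app {X Y Z : Scheme.{u}} {j : X ⟶ Y} {c : Y ⟶ Z} {c' : X ⟶ Z}
    (e : j ≫ c = c') {N : Y.Modules} {P : X.Modules}
    (φ : N ⟶ (Scheme.Modules.pushforward j).obj P) (U : Z.Opens) (h : IsIso (φ.app (c ⁻¹ᵁ U))) :
    IsIso (((Scheme.Modules.pushforward c).map φ ≫
      (Scheme.Modules.pushforwardComp j c).hom.app P ≫
        (Scheme.Modules.pushforwardCongr e).hom.app P).app U) := by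
  rw [Scheme.Modules.Hom.comp_app, Scheme.Modules.pushforward_map_app]
  exact IsIso.comp_isIso' h (Scheme.Modules.Hom.isIso_iff_isIso_app.mp inferInstance U)

variable {M A : Type u} [AddCommGroup M] [DecidableEq M] [CommRing A]
  {𝒜 : M → AddSubgroup A} [GradedRing 𝒜]

/-- The canonical map `chartSheaf f ⟶ chartSheaf g` is bijective on the open sets `U` with
`U ∩ U_f ⊆ U_g`. -/
theorem isIso_chartSheafMap_app {Q : Type u} [AddCommGroup Q] [Module A Q]
    (𝒬 : M → AddSubgroup Q) [SetLike.GradedSMul 𝒜 𝒬] {f g : FinRelevant 𝒜} (h : f ≤ g)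
    (U : (Proj 𝒜).Opens)
    (hU : ((chart f ⁻¹ᵁ U : (Spec _).Opens) : Set _) ⊆
      Set.range (specPotionMap (𝒜 := 𝒜) (f := f.carrier) (g := g.carrier) h)) :
    IsIso ((chartSheafMap 𝒜 𝒬 h).app U) := by
  obtain ⟨P, hPg, hP⟩ := exists_generator g.finite
  obtain ⟨w, hw⟩ := exists_isLocElement f.isRelevant
    (exists_mem_of_mem_closure g.isRelevant.homogeneous hPg)
  have hrange := range_specMap h hPg hP hw
  exact isIso_pushforward_map_comp_app (specPotionMap_chart h) _ U
    (isIso_tildeComap_app _ _ (hw.isLocalization h g.isRelevant.homogeneous hPg hP)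
      (fun z ↦ hw.modulePotionMap_surj 𝒬 h hP z)
      (fun z hz ↦ hw.exists_pow_smul_eq_zero 𝒬 h hP z hz) _
      (fun x hx ↦ hrange.subset (hU hx)))

/-- On an open set `V ⊆ U_g` a compatible family of sections is determined by its member on
`V ∩ U_g = V`, because passing from `f` to `f ∪ g` loses nothing: `V ∩ U_f = V ∩ U_{f ∪ g}`. -/
theorem isIso_limit_π_app {Q : Type u} [AddCommGroup Q] [Module A Q]
    (𝒬 : M → AddSubgroup Q) [SetLike.GradedSMul 𝒜 𝒬] (g : FinRelevant 𝒜) (V : (Proj 𝒜).Opens)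
    (hV : V ≤ (chart g).opensRange) :
    IsIso ((Limits.limit.π (chartSheafFunctor 𝒜 𝒬) g).app V) := by
  haveI : Limits.PreservesLimit (chartSheafFunctor 𝒜 𝒬 ⋙ Scheme.Modules.toPresheaf (Proj 𝒜))
      ((evaluation _ _).obj (.op V)) := Limits.evaluation_preservesLimit _ _
  refine (Limits.isLimitOfPreserves
    (Scheme.Modules.toPresheaf (Proj 𝒜) ⋙ (evaluation _ _).obj (.op V))
    (Limits.limit.isLimit (chartSheafFunctor 𝒜 𝒬))).isIso_π_app_of_monotone g
    ⟨fun f ↦ f.union g, fun _ _ h ↦ Set.union_subset_union_left _ h⟩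
    (fun _ _ ↦ Or.inl) (fun _ _ ↦ Or.inr) fun f ↦ ?_
  -- `V ∩ U_f ⊆ U_{f ∪ g}`, since `U_f ∩ U_g = U_{f ∪ g}`.
  refine isIso_chartSheafMap_app 𝒬 (g := f.union g) _ V fun x hx ↦ ?_
  obtain ⟨z, hz⟩ : chart f x ∈ Set.range (chart (f.union g)) :=
    range_chart_inter f g ▸ ⟨⟨x, rfl⟩, hV hx⟩
  refine ⟨z, (chart f).isOpenEmbedding.injective ?_⟩
  rw [← hz, ← specPotionMap_chart (f := f) (g := f.union g) fun _ ↦ Or.inl]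
  rfl

theorem isIso_restrictFunctor_map_limit_π {Q : Type u} [AddCommGroup Q] [Module A Q]
    (𝒬 : M → AddSubgroup Q) [SetLike.GradedSMul 𝒜 𝒬] (g : FinRelevant 𝒜) :
    IsIso ((Scheme.Modules.restrictFunctor (chart g)).map
      (Limits.limit.π (chartSheafFunctor 𝒜 𝒬) g)) :=
  Scheme.Modules.Hom.isIso_iff_isIso_app.mpr fun V ↦
    isIso_limit_π_app 𝒬 g (chart g ''ᵁ V) (Scheme.Hom.image_le_opensRange (f := chart g) V)

/-- Over `U_g` the sheaf associated with `Q` is the sheaf on `U_g` associated with `Q_(g)`. -/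
noncomputable def sheafOfGradedModuleRestrictChart {Q : Type u} [AddCommGroup Q] [Module A Q]
    (𝒬 : M → AddSubgroup Q) [SetLike.GradedSMul 𝒜 𝒬] (g : FinRelevant 𝒜) :
    (sheafOfGradedModule 𝒜 𝒬).restrict (chart g) ≅
      tilde (R := CommRingCat.of (potion 𝒜 g.carrier))
        (ModuleCat.of (potion 𝒜 g.carrier) (modulePotion 𝒜 𝒬 g.carrier)) :=
  @asIso _ _ _ _ _ (isIso_restrictFunctor_map_limit_π 𝒬 g) ≪≫
    (Scheme.Modules.restrictFunctorAdjCounitIso (chart g)).app _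

/-- A module which becomes isomorphic to the structure sheaf along an open immersion is isomorphic
to it on the image of that immersion. -/
theorem nonempty_restrict_opensRange_iso_unit {X Y : Scheme.{u}} (j : X ⟶ Y) [IsOpenImmersion j]
    {L : Y.Modules} (e : L.restrict j ≅ SheafOfModules.unit X.ringCatSheaf) :
    Nonempty (L.restrict j.opensRange.ι ≅
      SheafOfModules.unit (j.opensRange : Scheme.{u}).ringCatSheaf) :=
  ⟨(Scheme.Modules.restrictFunctorCongr j.isoOpensRange_inv_comp.symm).app L ≪≫
    (Scheme.Modules.restrictFunctorComp j.isoOpensRange.inv j).app L ≪≫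
    (Scheme.Modules.restrictFunctor j.isoOpensRange.inv).mapIso e ≪≫
    Scheme.Modules.restrictUnitIso j.isoOpensRange.inv⟩

theorem nonempty_twistingSheaf_restrict_chart_iso {g : FinRelevant 𝒜}
    (hg : degreeGroup 𝒜 g.carrier = ⊤) (α : M) :
    Nonempty ((twistingSheaf 𝒜 α).restrict (chart g) ≅ SheafOfModules.unit
      (Spec (CommRingCat.of (potion 𝒜 g.carrier))).ringCatSheaf) := by
  obtain ⟨e⟩ := exists_linearEquiv_modulePotion_twist hg α
  exact ⟨sheafOfGradedModuleRestrictChart (twist 𝒜 α) g ≪≫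
    (tilde.functor (CommRingCat.of (potion 𝒜 g.carrier))).mapIso e.toModuleIso.symm ≪≫ tildeSelf⟩

/-- If `f` is a relevant family with `M_f = M`, every point of `U_f` lies in a chart `U_g` for a
finite relevant `g` with `M_g = M`. -/
theorem exists_chart_degreeGroup_eq_top [AddGroup.FG M] {f : Set A} (hf : IsRelevant 𝒜 f)
    (hdeg : degreeGroup 𝒜 f = ⊤) {x : Proj 𝒜} (hx : x ∈ piece 𝒜 f) :
    ∃ g : FinRelevant 𝒜, degreeGroup 𝒜 g.carrier = ⊤ ∧ x ∈ (chart g).opensRange := by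
  obtain ⟨k, hk, hkfin, hktop⟩ := exists_finite_subset_degreeGroup_eq_top hdeg
  simp only [piece, Set.mem_iUnion] at hx
  obtain ⟨g, hgf, y, rfl⟩ := hx
  have hsub : g.carrier ∪ k ⊆ f := Set.union_subset hgf hk
  let g' : FinRelevant 𝒜 := ⟨g.carrier ∪ k, g.finite.union hkfin,
    g.isRelevant.mono Set.subset_union_left fun a ha ↦ hf.homogeneous a (hsub ha)⟩
  refine ⟨g', ?_, specPotionMap (𝒜 := 𝒜) (f := g'.carrier) hsub y, ?_⟩
  · rw [eq_top_iff, ← hktop]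
    exact degreeGroup_mono Set.subset_union_right
  · have h : g ≤ g' := Set.subset_union_left
    have hcomp : specPotionMap (𝒜 := 𝒜) (f := g'.carrier) hsub ≫
        specPotionMap (𝒜 := 𝒜) (f := g.carrier) (g := g'.carrier) h = specPotionMap hgf :=
      (Spec.map_comp _ _).symm.trans (congr_arg Spec.map (CommRingCat.hom_ext
        (RingHom.ext fun r ↦ potionMap_potionMap 𝒜 h hsub r)))
    rw [← hcomp, Category.assoc, specPotionMap_chart]
    rfl

end Geometry

end GradedProj

theorem mainTheorem5 {M A : Type u} [AddCommGroup M] [AddGroup.FG M] [DecidableEq M] [CommRing A]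
    (𝒜 : M → AddSubgroup A) [GradedRing 𝒜]
    (F : Set (Set A))
    (hrelevant : ∀ f ∈ F, GradedProj.IsRelevant 𝒜 f)
    (hdegree : ∀ f ∈ F, GradedProj.degreeGroup 𝒜 f = ⊤)
    (hcover : ⋃ f ∈ F, GradedProj.piece 𝒜 f = Set.univ) :
    ∀ α : M, GradedProj.IsInvertible (GradedProj.twistingSheaf 𝒜 α) := by
  intro α x
  obtain ⟨f, hf, hx⟩ := Set.mem_iUnion₂.mp (hcover ▸ Set.mem_univ x)
  obtain ⟨g, hg, hxg⟩ :=
    GradedProj.exists_chart_degreeGroup_eq_top (hrelevant f hf) (hdegree f hf) hx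
  obtain ⟨e⟩ := GradedProj.nonempty_twistingSheaf_restrict_chart_iso hg α
  exact ⟨_, hxg, GradedProj.nonempty_restrict_opensRange_iso_unit (GradedProj.chart g) e⟩
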